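/- \emph{Short-range infinite chess} is chess on the board $\mathbb Z^2$, with possibly infinitely many pieces, in which queens, rooks and bishops move at most seven squares per turn. Each player has exactly one king, pawns advance one square at a time (no double steps or en passant), and there is no promotion and no castling. Check, checkmate and stalemate are as usual; stalemate, threefold repetition, the fifty-move rule and infinite play are draws. A \emph{position} consists of an arrangement of pieces with exactly one king of each colour, the player to move, and the fifty-move counter, such that the player not to move is not in check; play starts there without prior history. In \emph{short-range infinite chess with passing for Black}, Black may in addition pass his turn whenever he is not in check; a pass counts as a turn without resetting the fifty-move counter, and if passing would be Black's only legal move, the game is still a draw by stalemate. The \emph{game value for White} is the partial ordinal-valued function on finite plays defined inductively as follows. A play in which Black has been checkmated has value $0$. A play in progress with Black to move has value $\alpha$ if all plays resulting from a legal move of Black have values and $\alpha$ is their supremum. A play in progress with White to move has value $\beta+1$ if some play resulting from a legal move of White has a value and $\beta$ is the least such value. All other plays have no value. \textbf{Corollary.} Let $p$ be a position whose game value for White in short-range infinite chess exists and is an ordinal $\alpha\ge\omega$. Then $p$ is not winning for White in short-range infinite chess with passing for Black, i.e. White has no strategy that wins against every play of Black from $p$ in that variant. -/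

import Mathlib

/-! ### Open games with draws and their ordinal game values -/

/-- The two players. -/
inductive Color where
  | white
  | black
  deriving DecidableEq

/-- The opponent. -/
def Color.other : Color → Color
  | .white => .black
  | .black => .white

/-- The initial segment of length `n` of an infinite sequence. -/
def initSeg {M : Type} (s : ℕ → M) (n : ℕ) : List M := (List.range n).map s

/-- An open Gale–Stewart game with draws: starting with `first`, the players alternately name
elements of `M`, forever.  Player `c` wins the infinite sequence produced if some initial segment of
it lies in `win c`; if neither player wins, the game is drawn.  No sequence is won by both. -/
structure OpenGame (M : Type) where
  first : Color
  win : Color → Set (List M)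
  disjoint : ∀ (s : ℕ → M) (i j : ℕ) (c c' : Color),
    initSeg s i ∈ win c → initSeg s j ∈ win c' → c = c'

namespace OpenGame

variable {M : Type} (G : OpenGame M)

/-- The player whose turn it is after the finite play `v`. -/
def toMove (v : List M) : Color := if Even v.length then G.first else G.first.other

/-- Player `c` has already guaranteed victory in the play `v`. -/
def Won (c : Color) (v : List M) : Prop := ∃ u, u <+: v ∧ u ∈ G.win c

/-- The ordinal game value of the play `v` for player `c` exists and is at most `α`. -/
inductive ValueLE (c : Color) : List M → Ordinal.{0} → Prop
  | won {v : List M} {α : Ordinal.{0}} : G.Won c v → ValueLE c v α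
  | own {v : List M} {α β : Ordinal.{0}} (m : M) : G.toMove v = c → β < α →
      ValueLE c (v ++ [m]) β → ValueLE c v α
  | opp {v : List M} {α : Ordinal.{0}} : G.toMove v ≠ c →
      (∀ m, ValueLE c (v ++ [m]) α) → ValueLE c v α

/-- The play `v` has ordinal game value `α` for player `c`.  The three lemmas
`hasValue_of_won`, `hasValue_opp_iff` and `hasValue_own_iff` below are the usual recursive clauses
(value `0` once won; supremum over all moves of the opponent; least value after an own move,
plus one). -/
def HasValue (c : Color) (v : List M) (α : Ordinal.{0}) : Prop :=
  IsLeast {β | G.ValueLE c v β} α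

/-- A strategy assigns a move to every finite play; it is winning for player `c` if every infinite
play in which `c` follows it is won by `c`. -/
def IsWinningStrategy (c : Color) (σ : List M → M) : Prop :=
  ∀ s : ℕ → M, (∀ n, G.toMove (initSeg s n) = c → s n = σ (initSeg s n)) →
    ∃ n, initSeg s n ∈ G.win c

/-- The game is winning for player `c`. -/
def IsWinningFor (c : Color) : Prop := ∃ σ : List M → M, G.IsWinningStrategy c σ

variable {G} {c : Color} {v : List M} {α β : Ordinal.{0}}

theorem ValueLE.mono (h : G.ValueLE c v α) (hab : α ≤ β) : G.ValueLE c v β := by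
  induction h generalizing β with
  | won h => exact .won h
  | own m ht hlt h _ => exact .own m ht (hlt.trans_le hab) h
  | opp ht _ ih => exact .opp ht fun m => ih m hab

theorem ValueLE.exists_hasValue (h : G.ValueLE c v α) : ∃ β ≤ α, G.HasValue c v β :=
  ⟨sInf {β | G.ValueLE c v β}, csInf_le' h, csInf_mem ⟨α, h⟩, fun _ hb => csInf_le' hb⟩

theorem hasValue_of_won (h : G.Won c v) : G.HasValue c v α ↔ α = 0 := by
  have h0 : G.HasValue c v 0 := ⟨.won h, fun _ _ => bot_le⟩
  exact ⟨fun ha => ha.unique h0, fun ha => ha ▸ h0⟩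

theorem hasValue_opp_iff (hw : ¬ G.Won c v) (ht : G.toMove v ≠ c) :
    G.HasValue c v α ↔
      ∃ f : M → Ordinal.{0}, (∀ m, G.HasValue c (v ++ [m]) (f m)) ∧ α = ⨆ m, f m := by
  have key : ∀ β, G.ValueLE c v β ↔ ∀ m, G.ValueLE c (v ++ [m]) β := by
    intro β
    refine ⟨fun h => ?_, .opp ht⟩
    cases h with
    | won h => exact absurd h hw
    | own m h _ _ => exact absurd h ht
    | opp _ h => exact h
  have main : ∀ f : M → Ordinal.{0}, (∀ m, G.HasValue c (v ++ [m]) (f m)) →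
      G.HasValue c v (⨆ m, f m) := by
    intro f hf
    refine ⟨(key _).2 fun m => (hf m).1.mono (Ordinal.le_iSup f m), fun β hβ => ?_⟩
    exact Ordinal.iSup_le fun m => (hf m).2 ((key β).1 hβ m)
  constructor
  · intro h
    choose f _ hf using fun m => ((key α).1 h.1 m).exists_hasValue
    exact ⟨f, hf, h.unique (main f hf)⟩
  · rintro ⟨f, hf, rfl⟩
    exact main f hf

theorem hasValue_own_iff (hw : ¬ G.Won c v) (ht : G.toMove v = c) :
    G.HasValue c v α ↔
      ∃ β, IsLeast {γ | ∃ m, G.HasValue c (v ++ [m]) γ} β ∧ α = β + 1 := by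
  have key : ∀ β, G.ValueLE c v β ↔ ∃ m, ∃ γ < β, G.ValueLE c (v ++ [m]) γ := by
    intro β
    refine ⟨fun h => ?_, fun ⟨m, γ, hγ, h⟩ => .own m ht hγ h⟩
    cases h with
    | won h => exact absurd h hw
    | own m _ hlt h => exact ⟨m, _, hlt, h⟩
    | opp h _ => exact absurd ht h
  have main : ∀ β, IsLeast {γ | ∃ m, G.HasValue c (v ++ [m]) γ} β →
      G.HasValue c v (β + 1) := by
    rintro β ⟨⟨m, hm⟩, hβ⟩
    refine ⟨(key _).2 ⟨m, β, lt_add_one β, hm.1⟩, fun δ hδ => ?_⟩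
    obtain ⟨m', γ, hγ, h⟩ := (key δ).1 hδ
    obtain ⟨γ', hγ', h'⟩ := h.exists_hasValue
    exact Order.add_one_le_of_lt (((hβ ⟨m', h'⟩).trans hγ').trans_lt hγ)
  constructor
  · intro h
    obtain ⟨m, γ, _, hm⟩ := (key α).1 h.1
    obtain ⟨γ', _, h'⟩ := hm.exists_hasValue
    have hl : IsLeast {γ | ∃ m, G.HasValue c (v ++ [m]) γ}
        (sInf {γ | ∃ m, G.HasValue c (v ++ [m]) γ}) :=
      ⟨csInf_mem ⟨γ', m, h'⟩, fun _ hb => csInf_le' hb⟩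
    exact ⟨_, hl, h.unique (main _ hl)⟩
  · rintro ⟨β, hβ, rfl⟩
    exact main β hβ

end OpenGame

/-! ### Short-range infinite chess -/

namespace ShortRangeChess

/-- The kinds of chess pieces. -/
inductive Kind where
  | king
  | queen
  | rook
  | bishop
  | knight
  | pawn
  deriving DecidableEq

/-- A chess piece. -/
structure Piece where
  color : Color
  kind : Kind
  deriving DecidableEq

/-- A square `(x, y)` of the infinite board; `y` increases to the north. -/
abbrev Square := ℤ × ℤ

/-- An arrangement of (possibly infinitely many) pieces. -/
abbrev Board := Square → Option Piece

/-- White pawns move north, black pawns move south. -/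
def forward : Color → ℤ
  | .white => 1
  | .black => -1

def straight : Set (ℤ × ℤ) := {(1, 0), (-1, 0), (0, 1), (0, -1)}

def diagonal : Set (ℤ × ℤ) := {(1, 1), (1, -1), (-1, 1), (-1, -1)}

def knightJumps : Set (ℤ × ℤ) :=
  {(1, 2), (2, 1), (2, -1), (1, -2), (-1, -2), (-2, -1), (-2, 1), (-1, 2)}

/-- The square `t` is reached from `s` in direction `d` after at most seven steps, all squares
strictly in between being empty. -/
def Slides (b : Board) (d : ℤ × ℤ) (s t : Square) : Prop :=
  ∃ n : ℕ, 1 ≤ n ∧ n ≤ 7 ∧ t = s + n • d ∧ ∀ i : ℕ, 0 < i → i < n → b (s + i • d) = none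

/-- The piece `q`, standing on `s`, attacks the square `t`. -/
def Attacks (b : Board) (q : Piece) (s t : Square) : Prop :=
  match q.kind with
  | .king => ∃ d ∈ straight ∪ diagonal, t = s + d
  | .queen => ∃ d ∈ straight ∪ diagonal, Slides b d s t
  | .rook => ∃ d ∈ straight, Slides b d s t
  | .bishop => ∃ d ∈ diagonal, Slides b d s t
  | .knight => ∃ d ∈ knightJumps, t = s + d
  | .pawn => t = s + (1, forward q.color) ∨ t = s + (-1, forward q.color)

/-- The king of player `c` is attacked. -/
def InCheck (b : Board) (c : Color) : Prop :=
  ∃ (k s : Square) (q : Piece), b k = some ⟨c, .king⟩ ∧ b s = some q ∧ q.color = c.other ∧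
    Attacks b q s k

/-- The piece `q`, standing on `s`, may move to `t`, disregarding the safety of its king.  There
are no double steps of pawns (hence no captures en passant), no promotion and no castling. -/
def CanMove (b : Board) (q : Piece) (s t : Square) : Prop :=
  (∀ r, b t = some r → r.color ≠ q.color) ∧
    if q.kind = .pawn then
      (b t = none ∧ t = s + (0, forward q.color)) ∨ (b t ≠ none ∧ Attacks b q s t)
    else Attacks b q s t

/-- The board after the piece on `s` has moved to `t` (capturing what stood there). -/
def moveBoard (b : Board) (s t : Square) : Board :=
  Function.update (Function.update b t (b s)) s none

/-- Player `c` may legally move a piece from `s` to `t`. -/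
def LegalMove (b : Board) (c : Color) (s t : Square) : Prop :=
  (∃ q, b s = some q ∧ q.color = c ∧ CanMove b q s t) ∧ ¬ InCheck (moveBoard b s t) c

def Checkmate (b : Board) (c : Color) : Prop :=
  InCheck b c ∧ ¬ ∃ s t, LegalMove b c s t

def Stalemate (b : Board) (c : Color) : Prop :=
  ¬ InCheck b c ∧ ¬ ∃ s t, LegalMove b c s t

/-- A position: the arrangement of the pieces, the player to move, and the number of turns (of
either player) since the last capture or pawn move. -/
structure Position where
  board : Board
  turn : Color
  clock : ℕ

/-- Each player has exactly one king, and the player who is not to move is not in check. -/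
def Position.IsValid (p : Position) : Prop :=
  (∃! k, p.board k = some ⟨.white, .king⟩) ∧ (∃! k, p.board k = some ⟨.black, .king⟩) ∧
    ¬ InCheck p.board p.turn.other

/-- What a player may name on a turn. -/
inductive Move where
  | move (s t : Square)
  | pass

open Classical in
/-- The position after the move from `s` to `t`. -/
noncomputable def Position.afterMove (p : Position) (s t : Square) : Position where
  board := moveBoard p.board s t
  turn := p.turn.other
  clock := if (∃ q, p.board s = some q ∧ q.kind = .pawn) ∨ p.board t ≠ none then 0 else p.clock + 1

/-- The position after a pass, which does not reset the counter. -/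
def Position.afterPass (p : Position) : Position where
  board := p.board
  turn := p.turn.other
  clock := p.clock + 1

/-- The state of a chess game.  While it is in progress, `past` lists the arrangements, with the
player to move, that have occurred so far, the present one included. -/
inductive State where
  | ongoing (p : Position) (past : List (Board × Color))
  | won (c : Color)
  | drawn

open Classical in
/-- The state of the game when the position `p` has just arisen after those in `past`: a win by
checkmate, a draw by stalemate, by the fifty-move rule (fifty moves of each player) or by threefold
repetition, or a game in progress. -/
noncomputable def arrive (p : Position) (past : List (Board × Color)) : State :=
  if Checkmate p.board p.turn then .won p.turn.other
  else if Stalemate p.board p.turn ∨ 100 ≤ p.clock ∨ 2 ≤ past.count (p.board, p.turn) then .drawn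
  else .ongoing p ((p.board, p.turn) :: past)

open Classical in
/-- One turn.  An illegal move loses at once; nothing matters after the end of the game.  A pass is
legal only for Black, only in the variant with passing, and only if Black is not in check. -/
noncomputable def step (passing : Bool) : State → Move → State
  | .ongoing p past, .move s t =>
      if LegalMove p.board p.turn s t then arrive (p.afterMove s t) past else .won p.turn.other
  | .ongoing p past, .pass =>
      if passing = true ∧ p.turn = .black ∧ ¬ InCheck p.board p.turn then arrive p.afterPass past
      else .won p.turn.other
  | .won c, _ => .won c
  | .drawn, _ => .drawn

/-- The state of the game started in position `p` after the play `v`. -/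
noncomputable def stateAfter (passing : Bool) (p : Position) (v : List Move) : State :=
  v.foldl (step passing) (arrive p [])

theorem stateAfter_won_mono (passing : Bool) (p : Position) (s : ℕ → Move) (c : Color) {i j : ℕ}
    (hij : i ≤ j) (h : stateAfter passing p (initSeg s i) = .won c) :
    stateAfter passing p (initSeg s j) = .won c := by
  induction j, hij using Nat.le_induction with
  | base => exact h
  | succ j _ ih =>
    have : initSeg s (j + 1) = initSeg s j ++ [s j] := by simp [initSeg, List.range_succ]
    rw [this, stateAfter, List.foldl_append]
    change step passing (stateAfter passing p (initSeg s j)) (s j) = _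
    rw [ih]
    rfl

/-- The game played from position `p`, with or without the option of passing for Black. -/
noncomputable def chessGame (passing : Bool) (p : Position) : OpenGame Move where
  first := p.turn
  win c := {v | stateAfter passing p v = .won c}
  disjoint s i j c c' hi hj := by
    have h1 := stateAfter_won_mono passing p s c (le_max_left i j) hi
    have h2 := stateAfter_won_mono passing p s c' (le_max_right i j) hj
    exact State.won.inj (h1.symm.trans h2)

/-- Short-range infinite chess from position `p`. -/
noncomputable def shortRange (p : Position) : OpenGame Move := chessGame false p

/-- Short-range infinite chess with passing for Black, from position `p`. -/
noncomputable def shortRangePassing (p : Position) : OpenGame Move := chessGame true p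

end ShortRangeChess

/-! A far-away Black move does no more for Black than a pass. Pieces reach at most seven squares, so
checks, answers to checks and checkmates are decided in a bounded region around the kings. If White
wins against passing, then White's reply to a pass also beats every Black move made far enough out.
Only the moves inside a finite box remain, and finitely many finite bounds have a finite maximum.
When Black is in check he cannot pass, but then every legal answer already lies in a bounded box.

To run this as an induction over White's winning tree, the claim is strengthened to `Robust`: one
finite `N` bounds the length of the win, without passing, from every position and history that looks
the same on `box N`. The Black step `Robust.black` contains the argument above;
`Robust.winsIn_arrive` checks that mate and the drawing rules respect the comparison. At the
starting position this gives a game value at most `N`, hence below `ω`. -/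

namespace ShortRangeChess

/-! ### Locality of the rules -/

/-- The squares whose coordinates are at most `R` in absolute value. -/
noncomputable def box (R : ℕ) : Finset Square := Finset.Icc (-(R : ℤ), -(R : ℤ)) ((R : ℤ), (R : ℤ))

theorem mem_box {R : ℕ} {s : Square} :
    s ∈ box R ↔ -(R : ℤ) ≤ s.1 ∧ s.1 ≤ R ∧ -(R : ℤ) ≤ s.2 ∧ s.2 ≤ R := by
  simp only [box, Finset.mem_Icc, Prod.le_def]
  tauto

theorem box_mono {R S : ℕ} (h : R ≤ S) {s : Square} (hs : s ∈ box R) : s ∈ box S := by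
  rw [mem_box] at *
  omega

theorem exists_mem_box (s : Square) : ∃ R, s ∈ box R := by
  refine ⟨s.1.natAbs + s.2.natAbs, ?_⟩
  rw [mem_box]
  omega

/-- The squares `s` and `t` are at most seven king moves apart. -/
def Close (s t : Square) : Prop :=
  t.1 ≤ s.1 + 7 ∧ s.1 ≤ t.1 + 7 ∧ t.2 ≤ s.2 + 7 ∧ s.2 ≤ t.2 + 7

theorem Close.symm {s t : Square} (h : Close s t) : Close t s := by
  unfold Close at *
  omega

theorem Close.mem_box {s t : Square} (h : Close s t) {R : ℕ} (hs : s ∈ box R) :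
    t ∈ box (R + 7) := by
  rw [ShortRangeChess.mem_box] at *
  unfold Close at h
  push_cast
  omega

theorem close_add_nsmul {d : ℤ × ℤ} (hd : d ∈ straight ∪ diagonal) (s : Square) {n : ℕ}
    (hn : n ≤ 7) : Close s (s + n • d) := by
  simp only [straight, diagonal, Set.mem_union, Set.mem_insert_iff, Set.mem_singleton_iff] at hd
  rcases hd with (rfl | rfl | rfl | rfl) | (rfl | rfl | rfl | rfl) <;> simp [Close] <;> omega

theorem Slides.close {b : Board} {d : ℤ × ℤ} (hd : d ∈ straight ∪ diagonal) {s t : Square}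
    (h : Slides b d s t) : Close s t := by
  obtain ⟨n, -, hn, rfl, -⟩ := h
  exact close_add_nsmul hd s hn

theorem Attacks.close {b : Board} {q : Piece} {s t : Square} (h : Attacks b q s t) :
    Close s t := by
  obtain ⟨c, k⟩ := q
  cases k
  case king =>
    obtain ⟨d, hd, rfl⟩ := h
    simpa using close_add_nsmul hd s (n := 1) (by norm_num)
  case queen =>
    obtain ⟨d, hd, h⟩ := h
    exact h.close hd
  case rook =>
    obtain ⟨d, hd, h⟩ := h
    exact h.close (Or.inl hd)
  case bishop =>
    obtain ⟨d, hd, h⟩ := h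
    exact h.close (Or.inr hd)
  case knight =>
    obtain ⟨d, hd, rfl⟩ := h
    simp only [knightJumps, Set.mem_insert_iff, Set.mem_singleton_iff] at hd
    rcases hd with rfl | rfl | rfl | rfl | rfl | rfl | rfl | rfl <;> simp [Close] <;> omega
  case pawn =>
    cases c <;> rcases h with rfl | rfl <;> simp [Close, forward] <;> omega

theorem Slides.congr {b b' : Board} {d : ℤ × ℤ} (hd : d ∈ straight ∪ diagonal) {s t : Square}
    (hb : ∀ u, Close s u → b u = b' u) (h : Slides b d s t) : Slides b' d s t := by
  obtain ⟨n, h1, h7, ht, h⟩ := h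
  refine ⟨n, h1, h7, ht, fun i hi hin => ?_⟩
  rw [← hb _ (close_add_nsmul hd s (by omega))]
  exact h i hi hin

theorem Attacks.congr {b b' : Board} {q : Piece} {s t : Square}
    (hb : ∀ u, Close s u → b u = b' u) (h : Attacks b q s t) : Attacks b' q s t := by
  obtain ⟨c, k⟩ := q
  cases k
  case king => exact h
  case queen =>
    obtain ⟨d, hd, h⟩ := h
    exact ⟨d, hd, h.congr hd hb⟩
  case rook =>
    obtain ⟨d, hd, h⟩ := h
    exact ⟨d, hd, h.congr (Or.inl hd) hb⟩
  case bishop =>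
    obtain ⟨d, hd, h⟩ := h
    exact ⟨d, hd, h.congr (Or.inr hd) hb⟩
  case knight => exact h
  case pawn => exact h

theorem CanMove.close {b : Board} {q : Piece} {s t : Square} (h : CanMove b q s t) :
    Close s t := by
  obtain ⟨-, h⟩ := h
  split_ifs at h
  · rcases h with ⟨-, rfl⟩ | ⟨-, h⟩
    · cases hc : q.color <;> simp [Close, forward] <;> omega
    · exact h.close
  · exact h.close

theorem CanMove.congr {b b' : Board} {q : Piece} {s t : Square}
    (hb : ∀ u, Close s u → b u = b' u) (h : CanMove b q s t) : CanMove b' q s t := by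
  have ht := hb t h.close
  obtain ⟨h1, h2⟩ := h
  refine ⟨ht ▸ h1, ?_⟩
  split_ifs at h2 ⊢
  · rw [← ht]
    exact h2.imp id fun h => ⟨h.1, h.2.congr hb⟩
  · exact h2.congr hb

theorem LegalMove.close {b : Board} {c : Color} {s t : Square} (h : LegalMove b c s t) :
    Close s t := by
  obtain ⟨⟨q, -, -, h⟩, -⟩ := h
  exact h.close

/-- Two boards agree on `box R` and have their kings on the same squares. -/
def Agree (R : ℕ) (b b' : Board) : Prop :=
  (∀ s ∈ box R, b s = b' s) ∧
    ∀ (s : Square) (c : Color), b s = some ⟨c, .king⟩ ↔ b' s = some ⟨c, .king⟩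

/-- All kings stand in `box r`. -/
def KingsIn (r : ℕ) (b : Board) : Prop :=
  ∀ (s : Square) (c : Color), b s = some ⟨c, .king⟩ → s ∈ box r

theorem Agree.refl (R : ℕ) (b : Board) : Agree R b b := ⟨fun _ _ => rfl, fun _ _ => Iff.rfl⟩

theorem Agree.symm {R : ℕ} {b b' : Board} (h : Agree R b b') : Agree R b' b :=
  ⟨fun s hs => (h.1 s hs).symm, fun s c => (h.2 s c).symm⟩

theorem Agree.trans {R : ℕ} {b b' b'' : Board} (h : Agree R b b') (h' : Agree R b' b'') :
    Agree R b b'' :=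
  ⟨fun s hs => (h.1 s hs).trans (h'.1 s hs), fun s c => (h.2 s c).trans (h'.2 s c)⟩

theorem Agree.anti {R S : ℕ} (hRS : R ≤ S) {b b' : Board} (h : Agree S b b') : Agree R b b' :=
  ⟨fun s hs => h.1 s (box_mono hRS hs), h.2⟩

theorem KingsIn.mono {r R : ℕ} (h : r ≤ R) {b : Board} (hb : KingsIn r b) : KingsIn R b :=
  fun s c hs => box_mono h (hb s c hs)

theorem KingsIn.congr {r R : ℕ} {b b' : Board} (hb : KingsIn r b) (h : Agree R b b') :
    KingsIn r b' :=
  fun s c hs => hb s c ((h.2 s c).2 hs)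

theorem KingsIn.moveBoard {r : ℕ} {b : Board} (hb : KingsIn r b) {s t : Square}
    (ht : t ∈ box r) : KingsIn r (moveBoard b s t) := by
  intro u c hu
  unfold ShortRangeChess.moveBoard at hu
  by_cases hus : u = s
  · simp [hus] at hu
  by_cases hut : u = t
  · exact hut ▸ ht
  · rw [Function.update_of_ne hus, Function.update_of_ne hut] at hu
    exact hb u c hu

theorem Agree.moveBoard {R : ℕ} {b b' : Board} (h : Agree R b b') {s : Square}
    (hs : s ∈ box R) (t : Square) : Agree R (moveBoard b s t) (moveBoard b' s t) := by
  unfold ShortRangeChess.moveBoard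
  constructor
  · intro u hu
    by_cases hus : u = s
    · simp [hus]
    by_cases hut : u = t
    · subst hut
      simp [Function.update_of_ne hus, h.1 s hs]
    · simp only [Function.update_of_ne hus, Function.update_of_ne hut, h.1 u hu]
  · intro u c
    by_cases hus : u = s
    · simp [hus]
    by_cases hut : u = t
    · subst hut
      simp [Function.update_of_ne hus, h.1 s hs]
    · simp only [Function.update_of_ne hus, Function.update_of_ne hut, h.2 u c]

/-- A move far from the kings is not noticed near them. -/
theorem agree_moveBoard {R : ℕ} {b : Board} (hb : KingsIn R b) {s t : Square}
    (hs : s ∉ box R) (ht : t ∉ box R) : Agree R b (moveBoard b s t) := by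
  unfold ShortRangeChess.moveBoard
  constructor
  · intro u hu
    rw [Function.update_of_ne (by rintro rfl; exact hs hu),
      Function.update_of_ne (by rintro rfl; exact ht hu)]
  · intro u c
    by_cases hus : u = s
    · subst hus
      simpa using fun h => hs (hb u c h)
    by_cases hut : u = t
    · subst hut
      rw [Function.update_of_ne hus, Function.update_self]
      exact ⟨fun h => absurd (hb u c h) ht, fun h => absurd (hb s c h) hs⟩
    · rw [Function.update_of_ne hus, Function.update_of_ne hut]

/-! ### Check, legality and mate depend only on a neighbourhood -/

/-- The margin is 7 + 7: an attacker is within seven of the king, and the squares its attack depends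
on are within seven of the attacker. Since `Agree` matches kings globally, no extra king can appear
outside the box. -/
theorem InCheck.congr {r R : ℕ} (hR : r + 14 ≤ R) {b b' : Board} (hb : KingsIn r b)
    (h : Agree R b b') {c : Color} (hc : InCheck b c) : InCheck b' c := by
  obtain ⟨k, s, q, hk, hs, hq, ha⟩ := hc
  have hs' : s ∈ box (r + 7) := ha.close.symm.mem_box (hb k c hk)
  refine ⟨k, s, q, (h.2 k c).1 hk, ?_, hq, ha.congr fun u hu => ?_⟩
  · rw [← h.1 s (box_mono (by omega) hs'), hs]
  · exact h.1 u (box_mono hR (hu.mem_box hs'))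

theorem inCheck_congr {r R : ℕ} (hR : r + 14 ≤ R) {b b' : Board} (hb : KingsIn r b)
    (h : Agree R b b') {c : Color} : InCheck b c ↔ InCheck b' c :=
  ⟨fun hc => hc.congr hR hb h, fun hc => hc.congr hR (hb.congr h) h.symm⟩

theorem LegalMove.congr {r R : ℕ} (hR : r + 14 ≤ R) {b b' : Board} (hb : KingsIn r b)
    (h : Agree R b b') {c : Color} {s t : Square} (hs : s ∈ box r) (ht : t ∈ box r)
    (hl : LegalMove b c s t) : LegalMove b' c s t := by
  obtain ⟨⟨q, hq, hqc, hm⟩, hc⟩ := hl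
  have hsR : s ∈ box R := box_mono (by omega) hs
  refine ⟨⟨q, by rw [← h.1 s hsR, hq], hqc, hm.congr fun u hu => ?_⟩, fun hc' => hc ?_⟩
  · exact h.1 u (box_mono (by omega) (hu.mem_box hs))
  · exact (inCheck_congr hR (hb.moveBoard ht) (h.moveBoard hsR t)).2 hc'

theorem legalMove_congr {r R : ℕ} (hR : r + 14 ≤ R) {b b' : Board} (hb : KingsIn r b)
    (h : Agree R b b') {c : Color} {s t : Square} (hs : s ∈ box r) (ht : t ∈ box r) :
    LegalMove b c s t ↔ LegalMove b' c s t :=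
  ⟨fun hl => hl.congr hR hb h hs ht, fun hl => hl.congr hR (hb.congr h) h.symm hs ht⟩

/-- Every answer to a check takes place near the king. -/
theorem LegalMove.mem_box_of_inCheck {r : ℕ} {b : Board} (hb : KingsIn r b) {c : Color}
    {s t : Square} (hc : InCheck b c) (hl : LegalMove b c s t) :
    s ∈ box (r + 21) ∧ t ∈ box (r + 21) := by
  by_cases hs : s ∈ box (r + 14)
  · exact ⟨box_mono (by omega) hs, hl.close.mem_box hs⟩
  by_cases ht : t ∈ box (r + 14)
  · exact ⟨hl.close.symm.mem_box ht, box_mono (by omega) ht⟩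
  -- With both ends outside `box (r + 14)`, the move alters nothing the check depends on, so the
  -- king stays in check.
  · exact absurd (hc.congr le_rfl hb (agree_moveBoard (hb.mono (by omega)) hs ht)) hl.2

/-- The margin is 21 + 14: escapes lie in `box (r + 21)`, and transferring their legality costs 14
more. Without the check, a legal move could exist arbitrarily far away. -/
theorem Checkmate.congr {r R : ℕ} (hR : r + 35 ≤ R) {b b' : Board} (hb : KingsIn r b)
    (h : Agree R b b') {c : Color} (hm : Checkmate b c) : Checkmate b' c := by
  have hc := hm.1.congr (by omega) hb h
  refine ⟨hc, ?_⟩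
  rintro ⟨s, t, hl⟩
  obtain ⟨hs, ht⟩ := hl.mem_box_of_inCheck (hb.congr h) hc
  exact hm.2 ⟨s, t, hl.congr (r := r + 21) (by omega) ((hb.congr h).mono (by omega)) h.symm hs ht⟩

/-! ### Nearby positions with their histories -/

/-- The position `p'` with history `past'` looks like `p` with history `past` on `box R`, and its
fifty-move counter is not larger. -/
structure Near (R : ℕ) (p : Position) (past : List (Board × Color)) (p' : Position)
    (past' : List (Board × Color)) : Prop where
  board : Agree R p.board p'.board
  turn : p.turn = p'.turn
  clock : p'.clock ≤ p.clock
  past : List.Forall₂ (fun e e' => Agree R e.1 e'.1 ∧ e.2 = e'.2) past past'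

theorem Near.refl (R : ℕ) (p : Position) (past : List (Board × Color)) :
    Near R p past p past :=
  ⟨Agree.refl _ _, rfl, le_rfl, List.forall₂_same.2 fun _ _ => ⟨Agree.refl _ _, rfl⟩⟩

theorem Near.anti {R S : ℕ} (hRS : R ≤ S) {p p' : Position} {past past' : List (Board × Color)}
    (h : Near S p past p' past') : Near R p past p' past' :=
  ⟨h.board.anti hRS, h.turn, h.clock, h.past.imp fun _ _ he => ⟨he.1.anti hRS, he.2⟩⟩

theorem Near.afterMove {R : ℕ} {p p' : Position} {past past' : List (Board × Color)}
    (h : Near R p past p' past') {s t : Square} (hs : s ∈ box R) (ht : t ∈ box R) :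
    Near R (p.afterMove s t) past (p'.afterMove s t) past' := by
  refine ⟨h.board.moveBoard hs t, congrArg Color.other h.turn, ?_, h.past⟩
  have := h.clock
  simp only [Position.afterMove, h.board.1 s hs, h.board.1 t ht]
  split_ifs <;> omega

/-- The comparison of a pass with a distant move. A pass always adds one to the counter, while a
move adds one or resets it; this is why `Near` asks only for an inequality of counters. -/
theorem Near.afterPass_afterMove {R : ℕ} {p p' : Position} {past past' : List (Board × Color)}
    (h : Near R p past p' past') (hp : KingsIn R p.board) {s t : Square} (hs : s ∉ box R)
    (ht : t ∉ box R) : Near R p.afterPass past (p'.afterMove s t) past' := by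
  refine ⟨h.board.trans (agree_moveBoard (hp.congr h.board) hs ht), congrArg Color.other h.turn,
    ?_, h.past⟩
  have := h.clock
  simp only [Position.afterMove, Position.afterPass]
  split_ifs <;> omega

open Classical in
-- Each past arrangement different from `b` is told apart from it by some square; a box containing
-- such squares for the finitely many entries keeps them apart in any similar history. Repetitions
-- may disappear, but none is created.
theorem exists_count_le (b : Board) (c : Color) (past : List (Board × Color)) :
    ∃ N, ∀ b' past', Agree N b b' →
      List.Forall₂ (fun e e' => Agree N e.1 e'.1 ∧ e.2 = e'.2) past past' →
      past'.count (b', c) ≤ past.count (b, c) := by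
  induction past with
  | nil =>
    refine ⟨0, fun b' past' _ h => ?_⟩
    cases h
    simp
  | cons e past ih =>
    obtain ⟨N, hN⟩ := ih
    obtain ⟨S, hS⟩ : ∃ S, ∀ b' e', Agree S b b' → Agree S e.1 e'.1 ∧ e.2 = e'.2 →
        e' = (b', c) → e = (b, c) := by
      by_cases hb : e.1 = b
      · refine ⟨0, fun b' e' _ he h => ?_⟩
        subst h
        exact Prod.ext hb he.2
      · obtain ⟨u, hu⟩ := Function.ne_iff.1 hb
        obtain ⟨S, hS⟩ := exists_mem_box u
        refine ⟨S, fun b' e' hb' he h => absurd ?_ hu⟩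
        subst h
        rw [he.1.1 u hS, hb'.1 u hS]
    refine ⟨max N S, fun b' past' hb h => ?_⟩
    cases h with
    | @cons _ e' _ past' he h =>
      have h1 := hN b' past' (hb.anti (le_max_left _ _))
        (h.imp fun _ _ he => ⟨he.1.anti (le_max_left _ _), he.2⟩)
      have h2 := hS b' e' (hb.anti (le_max_right _ _)) ⟨he.1.anti (le_max_right _ _), he.2⟩
      simp only [List.count_cons, beq_iff_eq]
      split_ifs <;> first | omega | tauto

/-! ### Forced wins -/

/-- White can force a win from the given state, when passing is allowed. -/
inductive Wins : State → Prop
  | won : Wins (.won .white)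
  | white {p : Position} {past : List (Board × Color)} (m : Move) : p.turn = .white →
      Wins (step true (.ongoing p past) m) → Wins (.ongoing p past)
  | black {p : Position} {past : List (Board × Color)} : p.turn = .black →
      (∀ m, Wins (step true (.ongoing p past) m)) → Wins (.ongoing p past)

/-- White can force a win in at most `n` own moves from the given state, when passing is not
allowed. -/
inductive WinsIn : State → ℕ → Prop
  | won {n : ℕ} : WinsIn (.won .white) n
  | white {p : Position} {past : List (Board × Color)} {n : ℕ} (m : Move) : p.turn = .white →
      WinsIn (step false (.ongoing p past) m) n → WinsIn (.ongoing p past) (n + 1)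
  | black {p : Position} {past : List (Board × Color)} {n : ℕ} : p.turn = .black →
      (∀ m, WinsIn (step false (.ongoing p past) m) n) → WinsIn (.ongoing p past) n

theorem WinsIn.mono {S : State} {m n : ℕ} (h : WinsIn S m) (hmn : m ≤ n) : WinsIn S n := by
  induction h generalizing n with
  | won => exact .won
  | white m ht _ ih =>
    obtain ⟨n, rfl⟩ : ∃ k, n = k + 1 := ⟨n - 1, by omega⟩
    exact .white m ht (ih (by omega))
  | black ht _ ih => exact .black ht fun m => ih m hmn

/-- In all states that look like the given one on a large box, White can force a win in a bounded
number of moves without passing. -/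
def Robust : State → Prop
  | .ongoing p past => (∃ r, KingsIn r p.board) →
      ∃ N, ∀ p' past', Near N p past p' past' → WinsIn (.ongoing p' past') N
  | .won c => c = .white
  | .drawn => False

/-! ### Robustness passes backwards through a turn -/

/-- Similar positions end the game no worse for White: mate is local, and for a game in progress
each drawing rule that fails at `p` also fails nearby. -/
theorem Robust.winsIn_arrive {p : Position} {past : List (Board × Color)} {r : ℕ}
    (hp : KingsIn r p.board) (h : Robust (arrive p past)) :
    ∃ N, ∀ p' past', Near N p past p' past' → WinsIn (arrive p' past') N := by
  unfold arrive at h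
  split_ifs at h with hm hd
  · refine ⟨r + 35, fun p' past' hn => ?_⟩
    have hm' := hm.congr le_rfl hp hn.board
    rw [hn.turn] at hm' h
    rw [arrive, if_pos hm', (h : p'.turn.other = .white)]
    exact .won
  · exact h.elim
  · push Not at hd
    obtain ⟨hst, hcl, hct⟩ := hd
    -- One concrete legal move, kept inside the box, rules out both mate and stalemate in all
    -- similar positions.
    obtain ⟨s, t, hl⟩ : ∃ s t, LegalMove p.board p.turn s t := by
      by_contra hno
      by_cases hc : InCheck p.board p.turn
      · exact hm ⟨hc, hno⟩
      · exact hst ⟨hc, hno⟩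
    obtain ⟨N, hN⟩ := h ⟨r, hp⟩
    obtain ⟨C, hC⟩ := exists_count_le p.board p.turn past
    obtain ⟨i, hi⟩ := exists_mem_box s
    obtain ⟨j, hj⟩ := exists_mem_box t
    -- `N` serves the continued game, `C` the repetition count, and the rest the legality of the
    -- move from `s` to `t`.
    refine ⟨N + C + (r + i + j + 14), fun p' past' hn => ?_⟩
    have hl' : LegalMove p'.board p'.turn s t := by
      rw [← hn.turn]
      exact hl.congr (r := r + i + j) (by omega) (hp.mono (by omega)) hn.board
        (box_mono (by omega) hi) (box_mono (by omega) hj)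
    have hct' := hC p'.board past' (hn.board.anti (by omega)) (hn.anti (by omega)).past
    have hcl' := hn.clock
    rw [arrive, if_neg fun hm' => hm'.2 ⟨s, t, hl'⟩, if_neg]
    · refine (hN _ _ ?_).mono (by omega)
      have hn' : Near N p past p' past' := hn.anti (by omega)
      exact ⟨hn'.board, hn'.turn, hn'.clock, .cons ⟨hn'.board, hn'.turn⟩ hn'.past⟩
    · rw [← hn.turn]
      rintro (hs | hs | hs)
      · exact hs.2 ⟨s, t, hn.turn ▸ hl'⟩
      · omega
      · exact absurd (hs.trans hct') (by omega)

/-- A single move of either player is robust. -/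
theorem Robust.step_move {p : Position} {past : List (Board × Color)} {r : ℕ}
    (hp : KingsIn r p.board) (s t : Square)
    (h : Robust (step true (.ongoing p past) (.move s t))) :
    ∃ N, ∀ p' past', Near N p past p' past' →
      WinsIn (step false (.ongoing p' past') (.move s t)) N := by
  obtain ⟨i, hi⟩ := exists_mem_box s
  obtain ⟨j, hj⟩ := exists_mem_box t
  have hp' : KingsIn (r + i + j) p.board := hp.mono (by omega)
  have hs : s ∈ box (r + i + j) := box_mono (by omega) hi
  have ht : t ∈ box (r + i + j) := box_mono (by omega) hj
  by_cases hl : LegalMove p.board p.turn s t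
  · rw [step, if_pos hl] at h
    obtain ⟨N, hN⟩ := Robust.winsIn_arrive (p := p.afterMove s t) (hp'.moveBoard ht) h
    refine ⟨N + (r + i + j + 14), fun p' past' hn => ?_⟩
    rw [step, if_pos (hn.turn ▸ hl.congr (by omega) hp' hn.board hs ht)]
    exact (hN _ _ ((hn.afterMove (box_mono (by omega) hs)
      (box_mono (by omega) ht)).anti (by omega))).mono (by omega)
  · rw [step, if_neg hl] at h
    refine ⟨r + i + j + 14, fun p' past' hn => ?_⟩
    rw [step, if_neg, ← hn.turn, (h : p.turn.other = .white)]
    · exact .won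
    · rw [← hn.turn]
      exact fun hl' => hl ((legalMove_congr (by omega) hp' hn.board hs ht).2 hl')

theorem Robust.white {p : Position} {past : List (Board × Color)} (m : Move)
    (ht : p.turn = .white) (h : Robust (step true (.ongoing p past) m)) :
    Robust (.ongoing p past) := by
  rintro ⟨r, hp⟩
  cases m with
  | move s t =>
    obtain ⟨N, hN⟩ := h.step_move hp s t
    exact ⟨N + 1, fun p' past' hn =>
      .white (.move s t) (hn.turn ▸ ht) (hN _ _ (hn.anti (by omega)))⟩
  | pass => simp [step, ht, Robust, Color.other] at h

/-- Moves within a fixed box are answered uniformly. -/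
theorem Robust.step_move_box {p : Position} {past : List (Board × Color)} {r : ℕ}
    (hp : KingsIn r p.board) (h : ∀ m, Robust (step true (.ongoing p past) m)) (R : ℕ) :
    ∃ N, ∀ p' past', Near N p past p' past' → ∀ s ∈ box R, ∀ t ∈ box R,
      WinsIn (step false (.ongoing p' past') (.move s t)) N := by
  choose N hN using fun e : Square × Square => (h (.move e.1 e.2)).step_move hp e.1 e.2
  refine ⟨(box R ×ˢ box R).sup N, fun p' past' hn s hs t ht => ?_⟩
  have hle : N (s, t) ≤ (box R ×ˢ box R).sup N := Finset.le_sup (Finset.mk_mem_product hs ht)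
  exact (hN (s, t) _ _ (hn.anti hle)).mono hle

theorem Robust.black {p : Position} {past : List (Board × Color)} (ht : p.turn = .black)
    (h : ∀ m, Robust (step true (.ongoing p past) m)) : Robust (.ongoing p past) := by
  rintro ⟨r, hp⟩
  suffices hR : ∃ R M, ∀ p' past', Near M p past p' past' → ∀ s t, LegalMove p'.board .black s t →
      ¬ (s ∈ box R ∧ t ∈ box R) → WinsIn (arrive (p'.afterMove s t) past') M by
    obtain ⟨R, M, hM⟩ := hR
    obtain ⟨N, hN⟩ := Robust.step_move_box hp h R
    refine ⟨N + M, fun p' past' hn => ?_⟩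
    have ht' : p'.turn = .black := hn.turn ▸ ht
    refine .black ht' fun m => ?_
    cases m with
    | pass =>
      simp only [step, ht', Color.other, Bool.false_eq_true, false_and, if_false]
      exact .won
    | move s t =>
      by_cases hb : s ∈ box R ∧ t ∈ box R
      · exact (hN p' past' (hn.anti (by omega)) s hb.1 t hb.2).mono (by omega)
      · rw [step, ht']
        split_ifs with hl
        · exact (hM p' past' (hn.anti (by omega)) s t hl hb).mono (by omega)
        · exact .won
  by_cases hc : InCheck p.board p.turn
  · refine ⟨r + 21, r + 14, fun p' past' hn s t hl hb => absurd ?_ hb⟩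
    exact hl.mem_box_of_inCheck (hp.congr hn.board) (ht ▸ hc.congr le_rfl hp hn.board)
  · have hpass := h .pass
    rw [step, if_pos ⟨rfl, ht, hc⟩] at hpass
    obtain ⟨N, hN⟩ := Robust.winsIn_arrive (p := p.afterPass) hp hpass
    refine ⟨N + r + 7, N + r, fun p' past' hn s t hl hb => ?_⟩
    have hs : s ∉ box (N + r) := fun hs => hb ⟨box_mono (by omega) hs, hl.close.mem_box hs⟩
    have ht : t ∉ box (N + r) := fun ht => hb ⟨hl.close.symm.mem_box ht, box_mono (by omega) ht⟩
    exact (hN _ _ ((hn.afterPass_afterMove (hp.mono (by omega)) hs ht).anti (by omega))).mono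
      (by omega)

theorem Wins.robust {S : State} (h : Wins S) : Robust S := by
  induction h with
  | won => rfl
  | white m ht _ ih => exact .white m ht ih
  | black ht _ ih => exact .black ht ih

/-! ### Plays and states -/

theorem stateAfter_append (passing : Bool) (p : Position) (v : List Move) (m : Move) :
    stateAfter passing p (v ++ [m]) = step passing (stateAfter passing p v) m := by
  simp [stateAfter]

theorem turn_eq_of_arrive {p q : Position} {past past' : List (Board × Color)}
    (h : arrive p past = .ongoing q past') : q.turn = p.turn := by
  unfold arrive at h
  split_ifs at h
  injection h with h
  rw [h]

theorem turn_eq_of_step {passing : Bool} {p q : Position} {past past' : List (Board × Color)}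
    {m : Move} (h : step passing (.ongoing p past) m = .ongoing q past') :
    q.turn = p.turn.other := by
  cases m <;> simp only [step] at h <;> split_ifs at h <;> exact turn_eq_of_arrive h

theorem toMove_append {M : Type} (G : OpenGame M) (v : List M) (m : M) :
    G.toMove (v ++ [m]) = (G.toMove v).other := by
  unfold OpenGame.toMove
  by_cases h : Even v.length <;> cases hf : G.first <;> simp [Nat.even_add_one, h, Color.other]

theorem turn_stateAfter (passing : Bool) (p : Position) (v : List Move) :
    ∀ {q : Position} {past : List (Board × Color)}, stateAfter passing p v = .ongoing q past →
      q.turn = (chessGame passing p).toMove v := by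
  induction v using List.reverseRecOn with
  | nil => exact fun h => turn_eq_of_arrive h
  | append_singleton v m ih =>
    intro q past h
    rw [stateAfter_append] at h
    rw [toMove_append]
    cases hv : stateAfter passing p v with
    | ongoing q' past' =>
      rw [hv] at h
      rw [turn_eq_of_step h, ih hv]
    | won c => rw [hv] at h; cases h
    | drawn => rw [hv] at h; cases h

theorem eq_black_of_ne_white {c : Color} (h : c ≠ .white) : c = .black := by
  cases c
  · exact absurd rfl h
  · rfl

/-- A winning strategy in the game with passing yields an inductively forced win. -/
theorem wins_of_isWinningFor {p : Position} (h : (shortRangePassing p).IsWinningFor .white) :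
    Wins (arrive p []) := by
  obtain ⟨σ, hσ⟩ := h
  by_contra hw
  have ex : ∀ v : List Move, ∃ m, ¬ Wins (stateAfter true p v) →
      ((shortRangePassing p).toMove v = .white → m = σ v) ∧
        ¬ Wins (stateAfter true p (v ++ [m])) := by
    intro v
    by_cases ht : (shortRangePassing p).toMove v = .white
    · refine ⟨σ v, fun hv => ⟨fun _ => rfl, fun hv' => hv ?_⟩⟩
      rw [stateAfter_append] at hv'
      cases hs : stateAfter true p v with
      | ongoing q past =>
        rw [hs] at hv'
        exact .white _ ((turn_stateAfter true p v hs).trans ht) hv'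
      | won c => rwa [hs] at hv'
      | drawn => rwa [hs] at hv'
    · by_cases hv : ∃ m, ¬ Wins (stateAfter true p (v ++ [m]))
      · obtain ⟨m, hm⟩ := hv
        exact ⟨m, fun _ => ⟨fun h => absurd h ht, hm⟩⟩
      · push Not at hv
        refine ⟨.pass, fun hv' => absurd ?_ hv'⟩
        simp only [stateAfter_append] at hv
        cases hs : stateAfter true p v with
        | ongoing q past =>
          rw [hs] at hv
          refine .black ?_ hv
          rw [turn_stateAfter true p v hs]
          exact eq_black_of_ne_white ht
        | won c => simpa [hs, step] using hv .pass
        | drawn => simpa [hs, step] using hv .pass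
  choose f hf using ex
  let play : ℕ → List Move := fun n => Nat.rec [] (fun _ v => v ++ [f v]) n
  have hplay : ∀ n, initSeg (fun i => f (play i)) n = play n := by
    intro n
    induction n with
    | zero => rfl
    | succ n ih =>
      have : initSeg (fun i => f (play i)) (n + 1) =
          initSeg (fun i => f (play i)) n ++ [f (play n)] := by
        simp [initSeg, List.range_succ]
      rw [this, ih]
  have hno : ∀ n, ¬ Wins (stateAfter true p (play n)) := by
    intro n
    induction n with
    | zero => exact hw
    | succ n ih => exact (hf _ ih).2
  obtain ⟨n, hn⟩ := hσ (fun i => f (play i)) fun n ht => by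
    rw [hplay] at ht ⊢
    exact (hf _ (hno n)).1 ht
  rw [hplay] at hn
  refine hno n ?_
  rw [show stateAfter true p (play n) = .won .white from hn]
  exact .won

theorem WinsIn.valueLE {p : Position} {S : State} {n : ℕ} (h : WinsIn S n) :
    ∀ v, stateAfter false p v = S → (shortRange p).ValueLE .white v n := by
  induction h with
  | won => exact fun v hv => .won ⟨v, List.prefix_rfl, hv⟩
  | @white q past n m ht _ ih =>
    intro v hv
    refine .own m ((turn_stateAfter false p v hv).symm.trans ht) (β := n) ?_ (ih _ ?_)
    · exact_mod_cast n.lt_succ_self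
    · rw [stateAfter_append, hv]
  | @black q past n ht _ ih =>
    intro v hv
    refine .opp ?_ fun m => ih m _ (by rw [stateAfter_append, hv])
    rw [show (shortRange p).toMove v = .black from (turn_stateAfter false p v hv).symm.trans ht]
    decide

theorem Position.IsValid.exists_kingsIn {p : Position} (hp : p.IsValid) :
    ∃ r, KingsIn r p.board := by
  obtain ⟨⟨w, -, hw⟩, ⟨k, -, hk⟩, -⟩ := hp
  obtain ⟨i, hi⟩ := exists_mem_box w
  obtain ⟨j, hj⟩ := exists_mem_box k
  refine ⟨i + j, fun s c hs => ?_⟩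
  cases c
  · exact hw s hs ▸ box_mono (by omega) hi
  · exact hk s hs ▸ box_mono (by omega) hj

end ShortRangeChess

theorem mainTheorem7 (p : ShortRangeChess.Position) (hp : p.IsValid) (α : Ordinal.{0})
    (hα : Ordinal.omega0 ≤ α)
    (hval : (ShortRangeChess.shortRange p).HasValue Color.white [] α) :
    ¬ (ShortRangeChess.shortRangePassing p).IsWinningFor Color.white := by
  intro h
  obtain ⟨r, hr⟩ := hp.exists_kingsIn
  obtain ⟨N, hN⟩ := (ShortRangeChess.wins_of_isWinningFor h).robust.winsIn_arrive hr
  have hle := hval.2 ((hN p [] (.refl _ _ _)).valueLE [] rfl)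
  exact absurd (hα.trans hle) (Ordinal.natCast_lt_omega0 N).not_ge
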